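/- Let $\eta\in\mathbb C$, $q=e^{\eta}$ and $q^{x}=e^{\eta x}$ for rational $x$. For natural $n$ let $[n]=\sum_{i=0}^{n-1}q^{\,n-1-2i}$, which is $(q^{n}-q^{-n})/(q-q^{-1})$ when $q^2\ne1$ and $n$ when $\eta=0$, and let $[n]!=[n][n-1]\cdots[1]$, $[0]!=1$. Assume $[n]\neq 0$ for all $n\ge 1$ (this holds in particular for every real $q>0$, including $q=1$). Fix square roots $[n]^{1/2}$ of the numbers $[n]$ (for real $q>0$, e.g. the positive ones), put $([n]!)^{1/2}=\prod_{i=1}^{n}[i]^{1/2}$, and read square roots of products and quotients of $q$-numbers and $q$-factorials multiplicatively. Rational numbers $a,b,c$ form a triad if $a+b-c$, $a-b+c$, $b+c-a$ are nonnegative integers (so $a,b,c\in\tfrac12\mathbb Z_{\ge0}$). Put $$\nabla[abc]=\left(\frac{[a+b-c]!\,[a-b+c]!\,[a+b+c+1]!}{[b+c-a]!}\right)^{1/2}.$$ The $q$-$6j$ coefficient is $$\left\{\begin{matrix}a&b&e\\ d&c&f\end{matrix}\right\}_{q}=\frac{\nabla[acf]\nabla[dbf]}{\nabla[abe]\nabla[dce]}\sum_{z}\frac{(-1)^{a+b+c+d+z}[c+f-a+z]!\,[b+f-d+z]!\,[a+d+e-f-z]!}{[z]!\,[a+c-f-z]!\,[b+d-f-z]!\,[e+f-a-d+z]!\,[2f+z+1]!}$$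 if $(a,b,e),(a,c,f),(d,b,f),(d,c,e)$ are triads, and $0$ otherwise; $z$ runs over the integers for which all factorial arguments in the denominator are nonnegative. The $q$-$9j$ coefficient is $$\left\{\begin{matrix}a&b&e\\ c&d&f\\ h&k&g\end{matrix}\right\}_{q}=\sum_{j}(-1)^{2j}q^{-d(d+1)-e(e+1)-h(h+1)-j(j+1)}[2j+1]\left\{\begin{matrix}a&c&h\\ k&g&j\end{matrix}\right\}_{q}\left\{\begin{matrix}k&j&c\\ f&d&b\end{matrix}\right\}_{q}\left\{\begin{matrix}a&g&j\\ f&b&e\end{matrix}\right\}_{q},$$ summed over all $j\in\frac12\mathbb Z_{\ge0}$ such that $(a,g,j),(f,b,j),(k,c,j)$ are triads. **Theorem.** Let $a=c+h$ and $e=a+b$, and let $(c,d,f)$, $(h,k,g)$, $(b,d,k)$, $(e,f,g)$ be triads. Then the doubly stretched $q$-$9j$ coefficient has the closed form $$\left\{\begin{matrix}c+h&b&b+c+h\\ c&d&f\\ h&k&g\end{matrix}\right\}_{q}=\frac{(-1)^{c+d-f}\,q^{2bc-e(e+1)-f(f+1)-h(h+1)-k(k+1)}\,\nabla[efg]}{\nabla[hgk]\,\nabla[cdf]\,\nabla[bdk]}\left(\frac{[2b]!\,[2c]!\,[2h]!}{[2a+1]\,[2e+1]!}\right)^{1/2}.$$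 -/

import Mathlib

/-- The power `q ^ x = exp (η x)` of `q = exp η`, for a rational exponent `x`. -/
noncomputable def qPow (η : ℂ) (x : ℚ) : ℂ := Complex.exp (η * (x : ℂ))

/-- The `q`-number `[n] = (q ^ n - q ^ (-n)) / (q - q ^ (-1))` of a natural number `n`, written as
the finite sum `q ^ (n - 1) + q ^ (n - 3) + ... + q ^ (1 - n)`, which also makes sense at `q = 1`,
where it is `n`. -/
noncomputable def qNum (η : ℂ) (n : ℕ) : ℂ :=
  ∑ i ∈ Finset.range n, qPow η ((n : ℚ) - 1 - 2 * (i : ℚ))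

theorem qNum_mul (η : ℂ) (n : ℕ) :
    qNum η n * (qPow η 1 - qPow η (-1)) = qPow η n - qPow η (-n) := by
  have key : ∀ m : ℕ, (∑ i ∈ Finset.range m, qPow η ((n : ℚ) - 1 - 2 * (i : ℚ))) *
      (qPow η 1 - qPow η (-1)) = qPow η n - qPow η ((n : ℚ) - 2 * (m : ℚ)) := by
    intro m
    induction m with
    | zero => simp
    | succ m ih =>
      rw [Finset.sum_range_succ, add_mul, ih, mul_sub]
      unfold qPow
      rw [← Complex.exp_add, ← Complex.exp_add]
      push_cast
      ring_nf
  have h := key n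
  rw [show ((n : ℚ) - 2 * (n : ℚ)) = -(n : ℚ) by ring] at h
  exact h

theorem qNum_zero_left (n : ℕ) : qNum 0 n = n := by
  simp [qNum, qPow]

/-- The `q`-factorial `[x]! = [x] [x - 1] ... [2] [1]` (used for `x` a natural number). -/
noncomputable def qFact (η : ℂ) (x : ℚ) : ℂ :=
  ∏ i ∈ Finset.range ⌊x⌋₊, qNum η (i + 1)

/-- The square root of the `q`-factorial `[x]!` (used for `x` a natural number) that comes from
chosen square roots `s n` of the `q`-numbers `[n]`. -/
noncomputable def sqrtQFact (s : ℕ → ℂ) (x : ℚ) : ℂ :=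
  ∏ i ∈ Finset.range ⌊x⌋₊, s (i + 1)

/-- The sign `(-1) ^ x` (used for `x` an integer). -/
noncomputable def qSign (x : ℚ) : ℂ := (-1 : ℂ) ^ ⌊x⌋

/-- The triangle condition: `a + b - c`, `a - b + c`, `b + c - a` are nonnegative integers.
(It forces `a`, `b`, `c` to be nonnegative integers or half-integers.) -/
def IsTriad (a b c : ℚ) : Prop :=
  (∃ n : ℕ, a + b - c = n) ∧ (∃ n : ℕ, a - b + c = n) ∧ (∃ n : ℕ, b + c - a = n)

/-- The asymmetric triangle coefficient
`∇[abc] = ([a + b - c]! [a - b + c]! [a + b + c + 1]! / [b + c - a]!) ^ (1/2)`. -/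
noncomputable def nabla (s : ℕ → ℂ) (a b c : ℚ) : ℂ :=
  sqrtQFact s (a + b - c) * sqrtQFact s (a - b + c) * sqrtQFact s (a + b + c + 1) /
    sqrtQFact s (b + c - a)

open Classical in
/-- The `q`-`6j` coefficient `{a b e; d c f}_q`. The summation runs over all natural `z` for which
the arguments of the factorials in the denominator are nonnegative. -/
noncomputable def q6j (η : ℂ) (s : ℕ → ℂ) (a b e d c f : ℚ) : ℂ :=
  if IsTriad a b e ∧ IsTriad a c f ∧ IsTriad d b f ∧ IsTriad d c e then
    nabla s a c f * nabla s d b f / (nabla s a b e * nabla s d c e) *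
      ∑ z ∈ (Finset.range (⌊a + c - f⌋₊ + 1)).filter
          (fun z : ℕ => 0 ≤ b + d - f - (z : ℚ) ∧ 0 ≤ e + f - a - d + (z : ℚ)),
        qSign (a + b + c + d + z) *
          (qFact η (c + f - a + z) * qFact η (b + f - d + z) * qFact η (a + d + e - f - z)) /
          (qFact η z * qFact η (a + c - f - z) * qFact η (b + d - f - z) *
            qFact η (e + f - a - d + z) * qFact η (2 * f + z + 1))
  else 0

open Classical in
/-- The `q`-`9j` coefficient `{a b e; c d f; h k g}_q`, with rows `(a b e)`, `(c d f)`, `(h k g)`,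
as a sum over `j = i / 2` of products of three `q`-`6j` coefficients; `j` runs over the values
allowed by the triangle conditions. -/
noncomputable def q9j (η : ℂ) (s : ℕ → ℂ) (a b e c d f h k g : ℚ) : ℂ :=
  ∑ i ∈ (Finset.range (⌊2 * (a + g)⌋₊ + 1)).filter
      (fun i : ℕ => IsTriad a g ((i : ℚ) / 2) ∧ IsTriad f b ((i : ℚ) / 2) ∧
        IsTriad k c ((i : ℚ) / 2)),
    (-1 : ℂ) ^ i *
      qPow η (-(d * (d + 1)) - e * (e + 1) - h * (h + 1) - (i : ℚ) / 2 * ((i : ℚ) / 2 + 1)) *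
      qNum η (i + 1) *
      q6j η s a c h k g ((i : ℚ) / 2) * q6j η s k ((i : ℚ) / 2) c f d b *
      q6j η s a g ((i : ℚ) / 2) f b e

/-! Each stretching condition collapses the alternating sum of one `q`-`6j` coefficient to a single
term: `a = c + h` in the first factor, `e = a + b` in the third. Only the middle factor keeps its
sum, with index `y`. The `∇` that depend on `j` cancel, and with `t = c + k - j` a double sum over
`t` and `y` of ratios of `q`-factorials remains, in which `[2j + 1]` is a very-well-poised factor.

For fixed `y` the sum over `t` is a limiting case of `6φ5` (`sum_very_well_poised`); the sum over
`y` left behind is of `q`-Chu-Vandermonde type (`sum_neg_one_pow_qfac_div`). One obstacle remains: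
the triad `(f, b, j)` restricts `t` from below, whereas the `6φ5` sum starts at `t = 0`. The missing
terms vanish, because there the sum over `y` is a `q`-difference of order larger than the degree of
its argument (`racah_sum_eq_zero`).

Notation: `B = c + d - f`, `P = c - d + f`, `D = b + d - k`, `G = b - d + k`, `r = k + f - b - c`.
The summations rest on the addition formula for `[m + n]` and never divide by `q - q⁻¹`, so `q = 1`
is no special case. -/

/-! ### Identities between `q`-numbers -/

theorem qPow_add (η : ℂ) (x y : ℚ) : qPow η (x + y) = qPow η x * qPow η y := by
  unfold qPow
  rw [← Complex.exp_add]
  push_cast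
  ring_nf

theorem qPow_zero (η : ℂ) : qPow η 0 = 1 := by simp [qPow]

theorem qNum_zero (η : ℂ) : qNum η 0 = 0 := by simp [qNum]

theorem qNum_succ (η : ℂ) (n : ℕ) :
    qNum η (n + 1) = qPow η 1 * qNum η n + qPow η (-n) := by
  unfold qNum
  rw [Finset.sum_range_succ, Finset.mul_sum]
  congr 1
  · refine Finset.sum_congr rfl fun i _ => ?_
    rw [← qPow_add]
    congr 1
    push_cast
    ring
  · congr 1
    push_cast
    ring

theorem qNum_add (η : ℂ) (m n : ℕ) :
    qNum η (m + n) = qPow η n * qNum η m + qPow η (-m) * qNum η n := by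
  induction n with
  | zero => simp [qNum_zero, qPow_zero]
  | succ n ih =>
    rw [← add_assoc, qNum_succ, qNum_succ, ih, Nat.cast_succ, qPow_add η n 1,
      show (-((m + n : ℕ) : ℚ)) = -m + -n by push_cast; ring, qPow_add]
    ring

theorem qNum_add' (η : ℂ) (m n : ℕ) :
    qNum η (m + n) = qPow η (-n) * qNum η m + qPow η m * qNum η n := by
  rw [add_comm, qNum_add]
  ring

theorem qNum_one (η : ℂ) : qNum η 1 = 1 := by
  simpa [qNum_zero, qPow_zero] using qNum_succ η 0

/-- It makes the difference of consecutive terms in `sum_very_well_poised` factor again. -/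
theorem qNum_mul_sub_mul (η : ℂ) (r u v : ℕ) :
    qNum η (r + u) * qNum η (r + v) - qNum η u * qNum η v =
      qNum η r * qNum η (r + u + v) := by
  have h1 := qNum_add η r u
  have h2 := qNum_add' η r v
  have h3 := qNum_add' η (r + v) u
  rw [show r + u + v = r + v + u by ring, qNum_add η (r + v) u, h2, h1]
  have e1 : qPow η (-r) * qPow η r = 1 := by rw [← qPow_add]; simp [qPow_zero]
  rw [show (-((r + v : ℕ) : ℚ)) = -r + -v by push_cast; ring, qPow_add]
  linear_combination (qNum η u * qNum η v) * e1

/-! ### `q`-binomial sums, `q`-differences and `q`-Chu-Vandermonde -/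

/-- The `q`-factorial of a natural number. -/
noncomputable def qfac (η : ℂ) (n : ℕ) : ℂ := ∏ i ∈ Finset.range n, qNum η (i + 1)

theorem qfac_zero (η : ℂ) : qfac η 0 = 1 := by simp [qfac]

theorem qfac_succ (η : ℂ) (n : ℕ) : qfac η (n + 1) = qfac η n * qNum η (n + 1) :=
  Finset.prod_range_succ _ _

theorem qfac_ne_zero {η : ℂ} (hη : ∀ n : ℕ, 1 ≤ n → qNum η n ≠ 0) (n : ℕ) : qfac η n ≠ 0 :=
  Finset.prod_ne_zero_iff.2 fun i _ => hη _ (Nat.le_add_left 1 i)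

/-- Multiplication of a `q`-binomial sum by `[y]` lowers its order. -/
theorem sum_qNum_mul_div_qfac {η : ℂ} (hη : ∀ n : ℕ, 1 ≤ n → qNum η n ≠ 0) (l : ℕ) (φ : ℕ → ℂ) :
    ∑ y ∈ Finset.range (l + 2), qNum η y * φ y / (qfac η y * qfac η (l + 1 - y)) =
      ∑ y ∈ Finset.range (l + 1), φ (y + 1) / (qfac η y * qfac η (l - y)) := by
  rw [Finset.sum_range_succ']
  simp only [qNum_zero, zero_mul, zero_div, add_zero]
  refine Finset.sum_congr rfl fun y _ => ?_
  rw [qfac_succ, show l + 1 - (y + 1) = l - y by omega]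
  have h1 := hη (y + 1) (by omega)
  have h2 := qfac_ne_zero hη y
  have h3 := qfac_ne_zero hη (l - y)
  field_simp

/-- The `q`-Pascal rule: for `l + 1 = y + x`, each term of `[l + 1] = q ^ y [x] + q ^ (-x) [y]`
cancels against one factorial of the denominator. It drives the inductions on the order of the sum.
-/
theorem qNum_mul_sum_div_qfac {η : ℂ} (hη : ∀ n : ℕ, 1 ≤ n → qNum η n ≠ 0) (l : ℕ) (φ : ℕ → ℂ) :
    qNum η (l + 1) * ∑ y ∈ Finset.range (l + 2), φ y / (qfac η y * qfac η (l + 1 - y)) =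
      ∑ y ∈ Finset.range (l + 1),
        (qPow η y * φ y + qPow η ((y : ℚ) - l) * φ (y + 1)) / (qfac η y * qfac η (l - y)) := by
  have h1 : ∀ y ∈ Finset.range (l + 2),
      qNum η (l + 1) * (φ y / (qfac η y * qfac η (l + 1 - y))) =
        qPow η y * φ y * qNum η (l + 1 - y) / (qfac η y * qfac η (l + 1 - y)) +
        qNum η y * (qPow η ((y : ℚ) - (l + 1)) * φ y) / (qfac η y * qfac η (l + 1 - y)) := by
    intro y hy
    obtain ⟨x, hx⟩ := Nat.exists_eq_add_of_le (Nat.lt_succ_iff.1 (Finset.mem_range.1 hy))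
    have hx' : (y : ℚ) - (l + 1) = -x := by
      have : ((l + 1 : ℕ) : ℚ) = ((y + x : ℕ) : ℚ) := by rw [hx]
      push_cast at this
      linarith
    rw [hx', hx, Nat.add_sub_cancel_left, qNum_add']
    ring
  rw [Finset.mul_sum, Finset.sum_congr rfl h1, Finset.sum_add_distrib,
    sum_qNum_mul_div_qfac hη, Finset.sum_range_succ]
  simp only [Nat.sub_self, qNum_zero, mul_zero, zero_div, add_zero]
  rw [← Finset.sum_add_distrib]
  refine Finset.sum_congr rfl fun y hy => ?_
  obtain ⟨x, rfl⟩ := Nat.exists_eq_add_of_le (Nat.lt_succ_iff.1 (Finset.mem_range.1 hy))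
  rw [show y + x + 1 - y = x + 1 by omega, Nat.add_sub_cancel_left, qfac_succ]
  have h1 := hη (x + 1) (by omega)
  have h2 := qfac_ne_zero hη y
  have h3 := qfac_ne_zero hη x
  rw [show ((y + 1 : ℕ) : ℚ) - ((y + x : ℕ) + 1) = (y : ℚ) - (y + x : ℕ) by push_cast; ring]
  field_simp

/-- The `q`-binomial theorem at the zeros of the product. -/
theorem sum_neg_one_pow_qPow_div_qfac {η : ℂ} (hη : ∀ n : ℕ, 1 ≤ n → qNum η n ≠ 0) (l : ℕ) :
    ∀ i < l, ∑ y ∈ Finset.range (l + 1),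
      (-1) ^ y * qPow η (((l : ℚ) - 1 - 2 * i) * y) / (qfac η y * qfac η (l - y)) = 0 := by
  induction l with
  | zero => intro i hi; omega
  | succ l ih =>
    intro i hi
    have key := qNum_mul_sum_div_qfac hη l
      (fun y => (-1) ^ y * qPow η ((((l + 1 : ℕ) : ℚ) - 1 - 2 * i) * y))
    refine (mul_eq_zero.1 (key.trans ?_)).resolve_left (hη _ (by omega))
    -- The two parts share the factor `1 - q ^ (-2i)`: it is zero for `i = 0`, and otherwise
    -- multiplies the sum of order `l` for `i - 1`.
    have h2 : ∀ y ∈ Finset.range (l + 1),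
        (qPow η y * ((-1) ^ y * qPow η ((((l + 1 : ℕ) : ℚ) - 1 - 2 * i) * y)) +
          qPow η ((y : ℚ) - l) * ((-1) ^ (y + 1) *
            qPow η ((((l + 1 : ℕ) : ℚ) - 1 - 2 * i) * ((y + 1 : ℕ) : ℚ)))) /
          (qfac η y * qfac η (l - y)) =
        (1 - qPow η (-2 * i)) * ((-1) ^ y * qPow η (((l : ℚ) + 1 - 2 * i) * y) /
          (qfac η y * qfac η (l - y))) := by
      intro y _
      have e1 : qPow η (((l : ℚ) + 1 - 2 * i) * y) =
          qPow η y * qPow η ((((l + 1 : ℕ) : ℚ) - 1 - 2 * i) * y) := by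
        rw [← qPow_add]; congr 1; push_cast; ring
      have e2 : qPow η (-2 * i) * qPow η (((l : ℚ) + 1 - 2 * i) * y) =
          qPow η ((y : ℚ) - l) * qPow η ((((l + 1 : ℕ) : ℚ) - 1 - 2 * i) * ((y + 1 : ℕ) : ℚ)) := by
        rw [← qPow_add, ← qPow_add]; congr 1; push_cast; ring
      rw [pow_succ]
      linear_combination ((-1) ^ y * e2 - (-1) ^ y * e1) / (qfac η y * qfac η (l - y))
    rw [Finset.sum_congr rfl h2, ← Finset.mul_sum]
    rcases i with _ | i
    · simp [qPow_zero]
    · rw [mul_eq_zero]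
      right
      rw [← ih i (by omega)]
      refine Finset.sum_congr rfl fun y _ => ?_
      congr 4
      push_cast
      ring

/-- A `q`-difference of order `l` annihilates products of fewer than `l` linear factors. -/
theorem sum_neg_one_pow_qPow_mul_prod_div_qfac {η : ℂ} (hη : ∀ n : ℕ, 1 ≤ n → qNum η n ≠ 0)
    {ι : Type*} [DecidableEq ι] (s : Finset ι) :
    ∀ (u v : ι → ℂ) (l i : ℕ), i + s.card < l →
      ∑ y ∈ Finset.range (l + 1),
        (-1) ^ y * qPow η (((l : ℚ) - 1 - s.card - 2 * i) * y) *
          (∏ x ∈ s, (u x * qPow η y + v x * qNum η y)) / (qfac η y * qfac η (l - y)) = 0 := by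
  induction s using Finset.induction_on with
  | empty =>
    intro u v l i hi
    simpa using sum_neg_one_pow_qPow_div_qfac hη l i (by simpa using hi)
  | insert x s hx ih =>
    intro u v l i hi
    rw [Finset.card_insert_of_notMem hx] at hi ⊢
    obtain ⟨l, rfl⟩ : ∃ l', l = l' + 1 := ⟨l - 1, by omega⟩
    -- The factor of `x` splits: `u x * q ^ y` is absorbed into the power of `q`, keeping the order;
    -- `v x * [y]` lowers the order by one and shifts `y`, after which the other factors are still
    -- linear, with the coefficients given in `h2`.
    have h1 := ih u v (l + 1) i (by omega)
    have h2 := ih (fun x => u x * qPow η 1 + v x) (fun x => v x * qPow η (-1)) l i (by omega)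
    set e : ℚ := (((l + 1 : ℕ) : ℚ) - 1 - ((s.card + 1 : ℕ) : ℚ) - 2 * i) with he
    have h3 := sum_qNum_mul_div_qfac hη l
      (fun y => (-1) ^ y * qPow η (e * y) * ∏ x ∈ s, (u x * qPow η y + v x * qNum η y))
    have h4 : ∑ y ∈ Finset.range (l + 1),
        ((-1) ^ (y + 1) * qPow η (e * ((y + 1 : ℕ) : ℚ)) *
          ∏ x ∈ s, (u x * qPow η ((y + 1 : ℕ) : ℚ) + v x * qNum η (y + 1))) /
          (qfac η y * qfac η (l - y)) = 0 := by
      rw [← mul_zero (-qPow η e), ← h2, Finset.mul_sum]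
      refine Finset.sum_congr rfl fun y _ => ?_
      have e1 : qPow η (e * ((y + 1 : ℕ) : ℚ)) =
          qPow η e * qPow η (((l : ℚ) - 1 - s.card - 2 * i) * y) := by
        rw [← qPow_add, he]; congr 1; push_cast; ring
      have e2 : ∏ x ∈ s, (u x * qPow η ((y + 1 : ℕ) : ℚ) + v x * qNum η (y + 1)) =
          ∏ x ∈ s, ((u x * qPow η 1 + v x) * qPow η y + v x * qPow η (-1) * qNum η y) := by
        refine Finset.prod_congr rfl fun x _ => ?_
        rw [qNum_add', qNum_one, Nat.cast_succ, qPow_add, Nat.cast_one]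
        ring
      rw [e1, e2, pow_succ]
      ring
    rw [h4] at h3
    calc _ = ∑ y ∈ Finset.range (l + 1 + 1),
          (u x * ((-1) ^ y * qPow η ((((l + 1 : ℕ) : ℚ) - 1 - s.card - 2 * i) * y) *
          (∏ x ∈ s, (u x * qPow η y + v x * qNum η y)) / (qfac η y * qfac η (l + 1 - y))) +
          v x * (qNum η y * ((-1) ^ y * qPow η (e * y) *
            ∏ x ∈ s, (u x * qPow η y + v x * qNum η y)) / (qfac η y * qfac η (l + 1 - y)))) := by
          refine Finset.sum_congr rfl fun y _ => ?_
          have e1 : qPow η ((((l + 1 : ℕ) : ℚ) - 1 - s.card - 2 * i) * y) =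
              qPow η (e * y) * qPow η y := by
            rw [← qPow_add, he]; congr 1; push_cast; ring
          rw [Finset.prod_insert hx, e1]
          ring
      _ = 0 := by
          rw [Finset.sum_add_distrib, ← Finset.mul_sum, ← Finset.mul_sum, h1, h3]
          ring

/-- The `q`-analogue of the Chu-Vandermonde summation formula. -/
theorem sum_neg_one_pow_qfac_div (η : ℂ) (hη : ∀ n : ℕ, 1 ≤ n → qNum η n ≠ 0) (B G : ℕ) :
    ∀ A : ℕ, ∑ y ∈ Finset.range (B + 1),
      ((-1) ^ y * qPow η (-((G : ℚ) + B) * y) * (qfac η (A + y) / qfac η (A + G + 1 + y))) /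
          (qfac η y * qfac η (B - y)) =
      qPow η (B * (A + 1)) * qfac η A * qfac η (G + B) /
        (qfac η B * qfac η G * qfac η (A + B + G + 1)) := by
  induction B with
  | zero =>
    intro A
    have h1 := qfac_ne_zero hη G
    simp [qPow_zero, qfac_zero]
    field_simp
  | succ B ih =>
    intro A
    have key := qNum_mul_sum_div_qfac hη B (fun y => (-1) ^ y * qPow η (-((G : ℚ) + (B + 1 : ℕ)) * y)
      * (qfac η (A + y) / qfac η (A + G + 1 + y)))
    have hB := hη (B + 1) (by omega)
    refine mul_left_cancel₀ hB (key.trans ?_)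
    -- The `q`-Pascal rule writes the sum as the one of order `B` at `A` minus a multiple of the one
    -- at `A + 1`; `e3` below recombines the two closed forms.
    have h2 : ∀ y ∈ Finset.range (B + 1),
        (qPow η y * ((-1) ^ y * qPow η (-((G : ℚ) + (B + 1 : ℕ)) * y) *
          (qfac η (A + y) / qfac η (A + G + 1 + y))) +
        qPow η ((y : ℚ) - B) * ((-1) ^ (y + 1) * qPow η (-((G : ℚ) + (B + 1 : ℕ)) * (y + 1 : ℕ)) *
          (qfac η (A + (y + 1)) / qfac η (A + G + 1 + (y + 1))))) / (qfac η y * qfac η (B - y)) =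
        ((-1) ^ y * qPow η (-((G : ℚ) + B) * y) * (qfac η (A + y) / qfac η (A + G + 1 + y))) /
          (qfac η y * qfac η (B - y)) - qPow η (-(G + 2 * B + 1)) *
        (((-1) ^ y * qPow η (-((G : ℚ) + B) * y) *
          (qfac η (A + 1 + y) / qfac η (A + 1 + G + 1 + y))) / (qfac η y * qfac η (B - y))) := by
      intro y _
      have e1 : qPow η (-((G : ℚ) + B) * y) = qPow η y * qPow η (-((G : ℚ) + (B + 1 : ℕ)) * y) := by
        rw [← qPow_add]; congr 1; push_cast; ring
      have e2 : qPow η (-(G + 2 * B + 1)) * qPow η (-((G : ℚ) + B) * y) =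
          qPow η ((y : ℚ) - B) * qPow η (-((G : ℚ) + (B + 1 : ℕ)) * (y + 1 : ℕ)) := by
        rw [← qPow_add, ← qPow_add]; congr 1; push_cast; ring
      rw [show A + (y + 1) = A + 1 + y by ring, show A + G + 1 + (y + 1) = A + 1 + G + 1 + y by ring,
        pow_succ]
      linear_combination ((-1) ^ y * (qfac η (A + 1 + y) / qfac η (A + 1 + G + 1 + y)) * e2 -
        (-1) ^ y * (qfac η (A + y) / qfac η (A + G + 1 + y)) * e1) / (qfac η y * qfac η (B - y))
    rw [Finset.sum_congr rfl h2, Finset.sum_sub_distrib, ← Finset.mul_sum, ih, ih]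
    have n1 := qfac_ne_zero hη B
    have n2 := qfac_ne_zero hη G
    have n3 := qfac_ne_zero hη (A + B + G + 1)
    have n4 := hη (A + B + G + 1 + 1) (by omega)
    rw [show A + 1 + B + G + 1 = A + B + G + 1 + 1 by ring,
      show A + (B + 1) + G + 1 = A + B + G + 1 + 1 by ring, ← add_assoc G B 1,
      qfac_succ η (A + B + G + 1), qfac_succ η A, qfac_succ η (G + B), qfac_succ η B]
    have e3 : qNum η (A + B + G + 1 + 1) = qPow η (-(G + B + 1)) * qNum η (A + 1) +
        qPow η (A + 1) * qNum η (G + B + 1) := by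
      rw [show A + B + G + 1 + 1 = (A + 1) + (G + B + 1) by ring, qNum_add']
      push_cast; ring
    have e4 : qPow η (-(G + 2 * B + 1)) * qPow η (B * ((A + 1 : ℕ) + 1)) =
        qPow η (B * (A + 1)) * qPow η (-(G + B + 1)) := by
      rw [← qPow_add, ← qPow_add]; congr 1; push_cast; ring
    have e5 : qPow η ((B + 1 : ℕ) * (A + 1)) = qPow η (B * (A + 1)) * qPow η (A + 1) := by
      rw [← qPow_add]; congr 1; push_cast; ring
    rw [e5]
    generalize qPow η (-(G + 2 * B + 1)) = x1 at *
    generalize qPow η (B * ((A + 1 : ℕ) + 1)) = x2 at *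
    field_simp
    rw [e3]
    linear_combination (-qfac η A * qfac η (G + B) * qNum η (A + 1)) * e4

/-! ### Very-well-poised summation -/

/-- With `n + 1` for `n`, this makes the weight in `sum_qNum_sub_two_mul` a difference `w t - w (t -
1)`, where `w t = q ^ (t (n - t)) / ([t]! [n - t]!)`. -/
theorem qNum_sub_two_mul (η : ℂ) {n t : ℕ} (h : 2 * t ≤ n) :
    qNum η (n - 2 * t) = qPow η (-t) * qNum η (n - t) - qPow η ((t : ℚ) - n) * qNum η t := by
  obtain ⟨u, rfl⟩ := Nat.exists_eq_add_of_le h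
  rw [Nat.add_sub_cancel_left, show 2 * t + u - t = u + t by omega, qNum_add]
  have e1 : qPow η (-t) * qPow η t = 1 := by rw [← qPow_add]; simp [qPow_zero]
  have e2 : qPow η (-t) * qPow η (-u) = qPow η ((t : ℚ) - (2 * t + u : ℕ)) := by
    rw [← qPow_add]; congr 1; push_cast; ring
  linear_combination (-qNum η u) * e1 - qNum η t * e2

/-- Summation by parts for very-well-poised sums. -/
theorem sum_qNum_sub_two_mul {η : ℂ} (hη : ∀ n : ℕ, 1 ≤ n → qNum η n ≠ 0) (φ : ℕ → ℂ) (n m : ℕ)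
    (h : 2 * m ≤ n) :
    ∑ t ∈ Finset.range (m + 1), qPow η (t * ((n : ℚ) + 1 - t)) * qNum η (n + 1 - 2 * t) * φ t /
        (qfac η t * qfac η (n + 1 - t)) =
      ∑ t ∈ Finset.range (m + 1), qPow η (t * ((n : ℚ) - t)) / (qfac η t * qfac η (n - t)) *
        (φ t - φ (t + 1)) +
      qPow η (m * ((n : ℚ) - m)) / (qfac η m * qfac η (n - m)) * φ (m + 1) := by
  induction m with
  | zero =>
    have h1 := hη (n + 1) (by omega)
    have h2 := qfac_ne_zero hη n
    simp [qPow_zero, qfac_zero, qfac_succ]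
    field_simp
    ring
  | succ m ih =>
    rw [Finset.sum_range_succ, ih (by omega), Finset.sum_range_succ _ (m + 1)]
    obtain ⟨u, rfl⟩ := Nat.exists_eq_add_of_le h
    rw [qNum_sub_two_mul η (by omega), show 2 * (m + 1) + u + 1 - (m + 1) = m + u + 1 + 1 by omega,
      show 2 * (m + 1) + u - m = m + u + 1 + 1 by omega,
      show 2 * (m + 1) + u - (m + 1) = m + u + 1 by omega, qfac_succ η (m + u + 1), qfac_succ η m]
    have h1 := hη (m + u + 1 + 1) (by omega)
    have h2 := qfac_ne_zero hη (m + u + 1)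
    have h3 := hη (m + 1) (by omega)
    have h4 := qfac_ne_zero hη m
    have e1 : qPow η ((m + 1 : ℕ) * (((2 * (m + 1) + u : ℕ) : ℚ) + 1 - (m + 1 : ℕ))) *
        qPow η (-(m + 1 : ℕ)) =
        qPow η ((m + 1 : ℕ) * (((2 * (m + 1) + u : ℕ) : ℚ) - (m + 1 : ℕ))) := by
      rw [← qPow_add]; congr 1; push_cast; ring
    have e2 : qPow η ((m + 1 : ℕ) * (((2 * (m + 1) + u : ℕ) : ℚ) + 1 - (m + 1 : ℕ))) *
        qPow η (((m + 1 : ℕ) : ℚ) - (2 * (m + 1) + u + 1 : ℕ)) =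
        qPow η (m * (((2 * (m + 1) + u : ℕ) : ℚ) - m)) := by
      rw [← qPow_add]; congr 1; push_cast; ring
    rw [← e1, ← e2]
    field_simp
    ring

/-- The limiting case of the very-well-poised `6φ5` summation formula. -/
theorem sum_very_well_poised {η : ℂ} (hη : ∀ n : ℕ, 1 ≤ n → qNum η n ≠ 0) (E x : ℕ) :
    ∀ R : ℕ, ∑ t ∈ Finset.range (min E x + 1),
      qPow η (t * (((E + R + x : ℕ) : ℚ) + 1 - t)) * qNum η (E + R + x + 1 - 2 * t) *
        (if t ≤ min E x then qfac η (R + x - t) * qfac η (E + R - t) /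
          (qfac η (E - t) * qfac η (x - t)) else 0) / (qfac η t * qfac η (E + R + x + 1 - t)) =
      qPow η (E * x) * qfac η R / (qfac η E * qfac η x) := by
  have hf := qfac_ne_zero hη
  intro R
  induction R with
  | zero =>
    -- The `if` makes the summand zero past `min E x`, where truncated subtraction would not. For `R
    -- = 0` it is `1` up to there, so only the difference at `t = min E x` survives.
    rw [sum_qNum_sub_two_mul hη _ _ _ (by omega), if_neg (by omega), mul_zero, add_zero,
      Finset.sum_range_succ, Finset.sum_eq_zero, if_pos le_rfl, if_neg (by omega), zero_add]
    · have h1 : qPow η ((min E x : ℕ) * (((E + 0 + x : ℕ) : ℚ) - (min E x : ℕ))) /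
          (qfac η (min E x) * qfac η (E + 0 + x - min E x)) =
          qPow η (E * x) / (qfac η E * qfac η x) := by
        rcases le_total E x with h | h
        · rw [min_eq_left h, show E + 0 + x - E = x by omega]
          congr 2
          push_cast; ring
        · rw [min_eq_right h, show E + 0 + x - x = E by omega, mul_comm (qfac η E)]
          congr 2
          push_cast; ring
      rw [h1, zero_add, add_zero, mul_comm (qfac η (x - _)),
        div_self (mul_ne_zero (hf _) (hf _)), qfac_zero]
      ring
    · intro t ht
      rw [Finset.mem_range] at ht
      rw [if_pos (by omega), if_pos (by omega), Nat.zero_add, Nat.add_zero,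
        mul_comm (qfac η (x - t)), mul_comm (qfac η (x - (t + 1))),
        div_self (mul_ne_zero (hf _) (hf _)), div_self (mul_ne_zero (hf _) (hf _)), sub_self,
        mul_zero]
  | succ R ih =>
    rw [sum_qNum_sub_two_mul hη _ _ _ (by omega), if_neg (by omega), mul_zero, add_zero, qfac_succ,
      mul_comm (qfac η R), ← mul_assoc, mul_comm (qPow η (E * x)), mul_assoc, mul_div_assoc, ← ih,
      Finset.mul_sum]
    refine Finset.sum_congr rfl fun t ht => ?_
    have ht := Nat.lt_succ_iff.1 (Finset.mem_range.1 ht)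
    obtain ⟨E, rfl⟩ := Nat.exists_eq_add_of_le (ht.trans (min_le_left _ _))
    obtain ⟨x, rfl⟩ := Nat.exists_eq_add_of_le (ht.trans (min_le_right _ _))
    rw [if_pos ht, if_pos ht, show ((t + E + (R + 1) + (t + x) : ℕ) : ℚ) =
      ((t + E + R + (t + x) : ℕ) : ℚ) + 1 by push_cast; ring,
      show t + E + (R + 1) + (t + x) = t + E + R + (t + x) + 1 by ring,
      show R + 1 + (t + x) - t = R + x + 1 by omega, show t + E + (R + 1) - t = E + R + 1 by omega,
      show R + (t + x) - t = R + x by omega, show t + E + R - t = E + R by omega,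
      show t + E - t = E by omega, show t + x - t = x by omega,
      show t + E + R + (t + x) + 1 - 2 * t = R + 1 + E + x by omega, qfac_succ, qfac_succ]
    -- Here `E` and `x` stand for the original ones minus `t`. The difference for `R + 1` is `[R +
    -- 1]` times the very-well-poised factor times the term for `R`.
    have key := qNum_mul_sub_mul η (R + 1) E x
    rw [show R + 1 + E = E + R + 1 by ring, show R + 1 + x = R + x + 1 by ring] at key
    have h2 : (if t + 1 ≤ min (t + E) (t + x) then
        qfac η (R + 1 + (t + x) - (t + 1)) * qfac η (t + E + (R + 1) - (t + 1)) /
          (qfac η (t + E - (t + 1)) * qfac η (t + x - (t + 1))) else 0) =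
        qNum η E * qNum η x * (qfac η (R + x) * qfac η (E + R) / (qfac η E * qfac η x)) := by
      split_ifs with h
      · obtain ⟨E, rfl⟩ : ∃ E', E = E' + 1 := ⟨E - 1, by omega⟩
        obtain ⟨x, rfl⟩ : ∃ x', x = x' + 1 := ⟨x - 1, by omega⟩
        rw [show R + 1 + (t + (x + 1)) - (t + 1) = R + (x + 1) by omega,
          show t + (E + 1) + (R + 1) - (t + 1) = E + 1 + R by omega,
          show t + (E + 1) - (t + 1) = E by omega, show t + (x + 1) - (t + 1) = x by omega,
          qfac_succ η E, qfac_succ η x]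
        have h1 := hf E
        have h2 := hf x
        have h3 := hη (E + 1) (by omega)
        have h4 := hη (x + 1) (by omega)
        field_simp
      · have : E = 0 ∨ x = 0 := by omega
        rcases this with rfl | rfl <;> simp [qNum_zero]
    rw [h2, show R + 1 + E = E + R + 1 by ring]
    linear_combination (qPow η (t * (((t + E + R + (t + x) : ℕ) : ℚ) + 1 - t)) /
      (qfac η t * qfac η (t + E + R + (t + x) + 1 - t)) *
      (qfac η (R + x) * qfac η (E + R) / (qfac η E * qfac η x))) * key

/-! ### Evaluation of the double sum -/

theorem qfac_add (η : ℂ) (m n : ℕ) :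
    qfac η (m + n) = qfac η m * ∏ i ∈ Finset.range n, qNum η (m + i + 1) :=
  Finset.prod_range_add _ _ _

theorem qNum_mul_qPow_sub (η : ℂ) {n y : ℕ} (h : y ≤ n) :
    qNum η n * qPow η y + -qPow η n * qNum η y = qNum η (n - y) := by
  obtain ⟨x, rfl⟩ := Nat.exists_eq_add_of_le' h
  have e1 : qPow η (-y) * qPow η y = 1 := by rw [← qPow_add]; simp [qPow_zero]
  rw [Nat.add_sub_cancel, qNum_add', Nat.cast_add, qPow_add]
  linear_combination qNum η x * e1

/-- The product continues the quotient of factorials by zero to `m < y ≤ m + n`, so a sum may be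
extended to such `y`. -/
theorem prod_qNum_mul_qPow_sub {η : ℂ} (hη : ∀ n : ℕ, 1 ≤ n → qNum η n ≠ 0) (m n y : ℕ)
    (h : y ≤ m + n) :
    ∏ i ∈ Finset.range n,
      (qNum η (m + i + 1) * qPow η y + -qPow η ((m + i + 1 : ℕ) : ℚ) * qNum η y) =
      if y ≤ m then qfac η (m + n - y) / qfac η (m - y) else 0 := by
  split_ifs with hy
  · obtain ⟨x, rfl⟩ := Nat.exists_eq_add_of_le hy
    rw [show y + x + n - y = x + n by omega, Nat.add_sub_cancel_left, qfac_add,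
      mul_div_cancel_left₀ _ (qfac_ne_zero hη x)]
    refine Finset.prod_congr rfl fun i _ => ?_
    rw [qNum_mul_qPow_sub η (by omega)]
    congr 1
    omega
  · refine Finset.prod_eq_zero (Finset.mem_range.2 (show y - m - 1 < n by omega)) ?_
    rw [show m + (y - m - 1) + 1 = y by omega, qNum_mul_qPow_sub η le_rfl, Nat.sub_self, qNum_zero]

/-- The alternating sum of a `q`-`6j` coefficient vanishes where a triangle condition fails. -/
theorem racah_sum_eq_zero {η : ℂ} (hη : ∀ n : ℕ, 1 ≤ n → qNum η n ≠ 0) (B P D G r t : ℕ)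
    (h : D + t < B) :
    ∑ y ∈ (Finset.range (B + 1)).filter (fun y => t + y ≤ B + P),
      (-1) ^ y * (qfac η (D + r + y) * qfac η (B + G - t + (r + y)) * qfac η (B + P - y)) /
        (qfac η (r + y) * qfac η (B - y) * qfac η (B + P - t - y) * qfac η y *
          qfac η (D + r + G + 1 + y)) = 0 := by
  have hf := qfac_ne_zero hη
  obtain ⟨w, rfl⟩ := Nat.exists_eq_add_of_lt h
  -- With `B = D + t + w + 1` the factorials give `D + w + P` linear factors over `[y]! [l - y]!`,
  -- where `l = D + w + P + 1`. The order exceeds the degree by exactly one, so no power of `q` is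
  -- needed.
  have key := sum_neg_one_pow_qPow_mul_prod_div_qfac hη
    ((Finset.range D).disjSum ((Finset.range w).disjSum (Finset.range P)))
    (Sum.elim (fun i => qNum η (r + i + 1)) (Sum.elim (fun i => qNum η (D + r + G + 1 + i + 1))
      (fun i => qNum η (D + t + w + 1 + i + 1))))
    (Sum.elim (fun i => qPow η (-(r + i + 1 : ℕ)))
      (Sum.elim (fun i => qPow η (-(D + r + G + 1 + i + 1 : ℕ)))
      (fun i => -qPow η ((D + t + w + 1 + i + 1 : ℕ) : ℚ)))) (D + w + P + 1) 0
    (by simp only [Finset.card_disjSum, Finset.card_range]; omega)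
  rw [← key]
  have h1 : ∀ n m y : ℕ, ∏ i ∈ Finset.range m,
      (qNum η (n + i + 1) * qPow η y + qPow η (-(n + i + 1 : ℕ)) * qNum η y) =
      qfac η (n + m + y) / qfac η (n + y) := by
    intro n m y
    rw [show n + m + y = n + y + m by ring, qfac_add, mul_div_cancel_left₀ _ (hf _)]
    refine Finset.prod_congr rfl fun i _ => ?_
    rw [show n + y + i + 1 = n + i + 1 + y by ring, qNum_add η (n + i + 1) y]
    ring
  simp only [Finset.prod_disjSum, Sum.elim_inl, Sum.elim_inr, Finset.card_disjSum,
    Finset.card_range, h1]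
  have hsub : (Finset.range (D + t + w + 1 + 1)).filter (fun y => t + y ≤ D + t + w + 1 + P) ⊆
      Finset.range (D + w + P + 1 + 1) := by
    intro y hy
    simp only [Finset.mem_filter, Finset.mem_range] at hy ⊢
    omega
  rw [← Finset.sum_subset hsub]
  · refine Finset.sum_congr rfl fun y hy => ?_
    simp only [Finset.mem_filter, Finset.mem_range] at hy
    rw [prod_qNum_mul_qPow_sub hη _ _ _ (by omega), if_pos (by omega),
      show ((D + w + P + 1 : ℕ) : ℚ) - 1 - (D + (w + P) : ℕ) - 2 * (0 : ℕ) = 0 by push_cast; ring,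
      zero_mul, qPow_zero, show D + t + w + 1 + G - t + (r + y) = D + r + G + 1 + w + y by omega,
      show D + t + w + 1 + P - t - y = D + w + P + 1 - y by omega, show D + r + y = r + D + y by ring]
    have := hf (r + y)
    have := hf (D + t + w + 1 - y)
    have := hf (D + w + P + 1 - y)
    have := hf y
    have := hf (D + r + G + 1 + y)
    field_simp
  · intro y hy hy'
    simp only [Finset.mem_filter, Finset.mem_range] at hy hy'
    rw [prod_qNum_mul_qPow_sub hη _ _ _ (by omega), if_neg (by omega)]
    simp

/-- For fixed `y`, `sum_very_well_poised` applies with `E = B + G`, `x = B + P - y`, `R = r + y`,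
whose sum is independent of `y`. The factor `q ^ (-(B + G) y)` in its value is the weight of the
Chu-Vandermonde sum with `A = D + r`. -/
theorem sum_racah_sum {η : ℂ} (hη : ∀ n : ℕ, 1 ≤ n → qNum η n ≠ 0) (B P D G r : ℕ) :
    ∑ t ∈ (Finset.range (min (B + G) (B + P) + 1)).filter (fun t => B ≤ D + t),
      qPow η (t * (((B + G + r + (B + P) : ℕ) : ℚ) + 1 - t)) *
        qNum η (B + G + r + (B + P) + 1 - 2 * t) * qfac η (r + (B + P) - t) /
        (qfac η (B + G - t) * qfac η t * qfac η (B + G + r + (B + P) + 1 - t)) *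
      ∑ y ∈ (Finset.range (B + 1)).filter (fun y => t + y ≤ B + P),
      (-1) ^ y * (qfac η (D + r + y) * qfac η (B + G - t + (r + y)) * qfac η (B + P - y)) /
        (qfac η (r + y) * qfac η (B - y) * qfac η (B + P - t - y) * qfac η y *
          qfac η (D + r + G + 1 + y)) =
      qPow η ((B + G : ℕ) * (B + P : ℕ) + B * ((D + r : ℕ) + 1)) * qfac η (D + r) /
        (qfac η B * qfac η G * qfac η (D + r + B + G + 1)) := by
  have hf := qfac_ne_zero hη
  -- The filter encodes `j ≤ f + b`; the terms it excludes vanish.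
  rw [Finset.sum_filter_of_ne]
  swap
  · intro t _ ht
    by_contra h
    exact ht (by rw [racah_sum_eq_zero hη _ _ _ _ _ _ (by omega), mul_zero])
  have h1 := sum_neg_one_pow_qfac_div η hη B G (D + r)
  have h2 : ∀ y ∈ Finset.range (B + 1),
      ∑ t ∈ Finset.range (min (B + G) (B + P) + 1), (if t + y ≤ B + P then
        qPow η (t * (((B + G + r + (B + P) : ℕ) : ℚ) + 1 - t)) *
        qNum η (B + G + r + (B + P) + 1 - 2 * t) * qfac η (r + (B + P) - t) /
        (qfac η (B + G - t) * qfac η t * qfac η (B + G + r + (B + P) + 1 - t)) *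
        ((-1) ^ y * (qfac η (D + r + y) * qfac η (B + G - t + (r + y)) * qfac η (B + P - y)) /
        (qfac η (r + y) * qfac η (B - y) * qfac η (B + P - t - y) * qfac η y *
          qfac η (D + r + G + 1 + y))) else 0) =
      qPow η ((B + G : ℕ) * (B + P : ℕ)) / qfac η (G + B) *
       (((-1) ^ y * qPow η (-((G : ℚ) + B) * y) * (qfac η (D + r + y) / qfac η (D + r + G + 1 + y))) /
          (qfac η y * qfac η (B - y))) := by
    intro y hy
    have hy := Nat.lt_succ_iff.1 (Finset.mem_range.1 hy)
    have key := sum_very_well_poised hη (B + G) (B + P - y) (r + y)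
    have hx : B + G + (r + y) + (B + P - y) = B + G + r + (B + P) := by omega
    rw [hx] at key
    have hsub : Finset.range (min (B + G) (B + P - y) + 1) ⊆
        Finset.range (min (B + G) (B + P) + 1) := by
      intro t
      simp only [Finset.mem_range]
      omega
    rw [← Finset.sum_subset hsub]
    swap
    · intro t ht ht'
      rw [Finset.mem_range] at ht ht'
      rw [if_neg (by omega)]
    have e1 : qPow η ((B + G : ℕ) * ((B + P - y : ℕ) : ℚ)) =
        qPow η ((B + G : ℕ) * (B + P : ℕ)) * qPow η (-((G : ℚ) + B) * y) := by
      rw [← qPow_add, Nat.cast_sub (by omega)]; congr 1; push_cast; ring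
    rw [e1] at key
    trans ((-1) ^ y * (qfac η (D + r + y) * qfac η (B + P - y)) /
        (qfac η (r + y) * qfac η (B - y) * qfac η y * qfac η (D + r + G + 1 + y))) *
      (qPow η ((B + G : ℕ) * (B + P : ℕ)) * qPow η (-((G : ℚ) + B) * y) * qfac η (r + y) /
        (qfac η (B + G) * qfac η (B + P - y)))
    · rw [← key, Finset.mul_sum]
      refine Finset.sum_congr rfl fun t ht => ?_
      have ht := Nat.lt_succ_iff.1 (Finset.mem_range.1 ht)
      rw [if_pos (by omega), if_pos ht, show r + y + (B + P - y) - t = r + (B + P) - t by omega,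
        show B + P - y - t = B + P - t - y by omega,
        show B + G + (r + y) - t = B + G - t + (r + y) by omega]
      ring
    · have := hf (r + y)
      have := hf (B + P - y)
      rw [add_comm B G]
      field_simp
  simp only [Finset.mul_sum, Finset.sum_filter, mul_ite, mul_zero]
  rw [Finset.sum_comm, Finset.sum_congr rfl h2, ← Finset.mul_sum, h1, qPow_add]
  have := hf (G + B)
  field_simp

/-! ### Square roots and the coefficients `∇` -/

/-- The product of the chosen square roots of `[1], ..., [n]`. -/
noncomputable def sqrtQfac (s : ℕ → ℂ) (n : ℕ) : ℂ := ∏ i ∈ Finset.range n, s (i + 1)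

theorem qFact_eq {η : ℂ} {x : ℚ} {n : ℕ} (h : x = n) : qFact η x = qfac η n := by
  rw [qFact, h, Nat.floor_natCast, qfac]

theorem sqrtQFact_eq {s : ℕ → ℂ} {x : ℚ} {n : ℕ} (h : x = n) : sqrtQFact s x = sqrtQfac s n := by
  rw [sqrtQFact, h, Nat.floor_natCast, sqrtQfac]

theorem qSign_eq {x : ℚ} {n : ℕ} (h : x = n) : qSign x = (-1) ^ n := by
  rw [qSign, h, Int.floor_natCast, zpow_natCast]

theorem sqrtQfac_sq {η : ℂ} {s : ℕ → ℂ} (hs : ∀ n : ℕ, s n ^ 2 = qNum η n) (n : ℕ) :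
    sqrtQfac s n ^ 2 = qfac η n := by
  simp only [sqrtQfac, qfac, ← Finset.prod_pow, hs]

theorem sqrtQfac_ne_zero {η : ℂ} {s : ℕ → ℂ} (hη : ∀ n : ℕ, 1 ≤ n → qNum η n ≠ 0)
    (hs : ∀ n : ℕ, s n ^ 2 = qNum η n) (n : ℕ) : sqrtQfac s n ≠ 0 := by
  have := qfac_ne_zero hη n
  rw [← sqrtQfac_sq hs] at this
  exact fun h => this (by rw [h]; ring)

theorem sqrtQFact_sq {η : ℂ} {s : ℕ → ℂ} (hs : ∀ n : ℕ, s n ^ 2 = qNum η n) (x : ℚ) :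
    sqrtQFact s x ^ 2 = qFact η x :=
  sqrtQfac_sq hs _

theorem sqrtQFact_ne_zero {η : ℂ} {s : ℕ → ℂ} (hη : ∀ n : ℕ, 1 ≤ n → qNum η n ≠ 0)
    (hs : ∀ n : ℕ, s n ^ 2 = qNum η n) (x : ℚ) : sqrtQFact s x ≠ 0 :=
  sqrtQfac_ne_zero hη hs _

theorem nabla_ne_zero {η : ℂ} {s : ℕ → ℂ} (hη : ∀ n : ℕ, 1 ≤ n → qNum η n ≠ 0)
    (hs : ∀ n : ℕ, s n ^ 2 = qNum η n) (a b c : ℚ) : nabla s a b c ≠ 0 :=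
  have h := sqrtQFact_ne_zero hη hs
  div_ne_zero (mul_ne_zero (mul_ne_zero (h _) (h _)) (h _)) (h _)

theorem nabla_swap_right (s : ℕ → ℂ) (a b c : ℚ) : nabla s a c b = nabla s a b c := by
  unfold nabla
  rw [show a + c - b = a - b + c by ring, show a - c + b = a + b - c by ring,
    show a + c + b + 1 = a + b + c + 1 by ring, add_comm c b]
  ring

/-- `∇` is symmetric only in its last two arguments. Reversing the order changes it by a quotient of
full factorials, without square roots. -/
theorem nabla_mul_qFact {η : ℂ} {s : ℕ → ℂ} (hη : ∀ n : ℕ, 1 ≤ n → qNum η n ≠ 0)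
    (hs : ∀ n : ℕ, s n ^ 2 = qNum η n) (a b c : ℚ) :
    nabla s a b c * qFact η (b + c - a) = nabla s c b a * qFact η (a + b - c) := by
  unfold nabla
  rw [← sqrtQFact_sq hs, ← sqrtQFact_sq hs, show c + b - a = b + c - a by ring,
    show c - b + a = a - b + c by ring, show c + b + a + 1 = a + b + c + 1 by ring, add_comm b a]
  have h1 := sqrtQFact_ne_zero hη hs (b + c - a)
  have h2 := sqrtQFact_ne_zero hη hs (a + b - c)
  field_simp

theorem nabla_mul_nabla {η : ℂ} {s : ℕ → ℂ} (hη : ∀ n : ℕ, 1 ≤ n → qNum η n ≠ 0)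
    (hs : ∀ n : ℕ, s n ^ 2 = qNum η n) (a b c : ℚ) :
    nabla s a b c * nabla s c b a = qFact η (a - b + c) * qFact η (a + b + c + 1) := by
  unfold nabla
  rw [← sqrtQFact_sq hs, ← sqrtQFact_sq hs, show c + b - a = b + c - a by ring,
    show c - b + a = a - b + c by ring, show c + b + a + 1 = a + b + c + 1 by ring, add_comm b a]
  have h1 := sqrtQFact_ne_zero hη hs (b + c - a)
  have h2 := sqrtQFact_ne_zero hη hs (a + b - c)
  field_simp

theorem IsTriad.swap_right {a b c : ℚ} (h : IsTriad a b c) : IsTriad a c b := by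
  obtain ⟨⟨x, hx⟩, ⟨y, hy⟩, ⟨z, hz⟩⟩ := h
  exact ⟨⟨y, by linarith⟩, ⟨x, by linarith⟩, ⟨z, by linarith⟩⟩

theorem IsTriad.reverse {a b c : ℚ} (h : IsTriad a b c) : IsTriad c b a := by
  obtain ⟨⟨x, hx⟩, ⟨y, hy⟩, ⟨z, hz⟩⟩ := h
  exact ⟨⟨z, by linarith⟩, ⟨y, by linarith⟩, ⟨x, by linarith⟩⟩

/-! ### The three `q`-`6j` coefficients -/

/-- The `q`-`6j` coefficient `{a c h; k g j}` that is stretched in `a = c + h`. -/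
theorem q6j_of_left_eq_add (η : ℂ) (s : ℕ → ℂ) {a c h k g j : ℚ} (ha : a = c + h)
    (t₁ : IsTriad a c h) (t₂ : IsTriad a g j) (t₃ : IsTriad k c j) (t₄ : IsTriad k g h)
    {t n₁ n₂ n₃ m₁ m₂ σ : ℕ} (ht : c + k - j = t) (h₁ : g + k - h = n₁) (h₂ : 2 * c = n₂)
    (h₃ : 2 * h = n₃) (h₄ : h + g - k = m₁) (h₅ : c + k + j + 1 = m₂)
    (hσ : a + c + g + k + (c + k - j) = σ) :
    q6j η s a c h k g j = nabla s a g j * nabla s k c j / (nabla s a c h * nabla s k g h) *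
      ((-1) ^ σ * (qfac η n₁ * qfac η n₂ * qfac η n₃) / (qfac η t * qfac η m₁ * qfac η m₂)) := by
  rw [q6j, if_pos ⟨t₁, t₂, t₃, t₄⟩]
  -- As `a = c + h`, the two conditions bound `z` by `c + k - j` from above and from below.
  have hset : (Finset.range (⌊a + g - j⌋₊ + 1)).filter
      (fun z : ℕ => 0 ≤ c + k - j - (z : ℚ) ∧ 0 ≤ h + j - a - k + (z : ℚ)) = {t} := by
    ext z
    simp only [Finset.mem_filter, Finset.mem_range, Finset.mem_singleton]
    constructor
    · rintro ⟨_, h6, h7⟩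
      have h8 : (z : ℚ) ≤ t := by linarith
      have h9 : (t : ℚ) ≤ z := by linarith
      exact le_antisymm (by exact_mod_cast h8) (by exact_mod_cast h9)
    · rintro rfl
      refine ⟨Nat.lt_succ_of_le (Nat.le_floor ?_), by linarith, by linarith⟩
      have : (0 : ℚ) ≤ (m₁ : ℚ) := by positivity
      linarith
  rw [hset, Finset.sum_singleton, qSign_eq (n := σ) (by linarith), qFact_eq (n := n₁) (by linarith),
    qFact_eq (n := n₂) (by linarith), qFact_eq (n := n₃) (by linarith), qFact_eq (n := t) rfl,
    qFact_eq (n := m₁) (by linarith), qFact_eq (n := 0) (by push_cast; linarith),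
    qFact_eq (n := 0) (by push_cast; linarith), qFact_eq (n := m₂) (by linarith), qfac_zero, mul_one,
    mul_one]

/-- The `q`-`6j` coefficient `{a g j; f b e}` that is stretched in `e = a + b`. -/
theorem q6j_of_right_eq_add (η : ℂ) (s : ℕ → ℂ) {a g j f b e : ℚ} (he : e = a + b)
    (t₁ : IsTriad a g j) (t₂ : IsTriad a b e) (t₃ : IsTriad f g e) (t₄ : IsTriad f b j)
    {n₁ n₂ n₃ m₁ m₂ m₃ σ : ℕ} (h₁ : 2 * b = n₁) (h₂ : g + e - f = n₂) (h₃ : f + j - b = n₃)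
    (h₄ : g + f - e = m₁) (h₅ : j + b - f = m₂) (h₆ : 2 * e + 1 = m₃) (hσ : a + g + b + f = σ) :
    q6j η s a g j f b e = nabla s a b e * nabla s f g e / (nabla s a g j * nabla s f b j) *
      ((-1) ^ σ * (qfac η n₁ * qfac η n₂ * qfac η n₃) / (qfac η m₁ * qfac η m₂ * qfac η m₃)) := by
  rw [q6j, if_pos ⟨t₁, t₂, t₃, t₄⟩]
  have hset : (Finset.range (⌊a + b - e⌋₊ + 1)).filter
      (fun z : ℕ => 0 ≤ g + f - e - (z : ℚ) ∧ 0 ≤ j + e - a - f + (z : ℚ)) = {0} := by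
    ext z
    have h7 : (0 : ℚ) ≤ (m₁ : ℚ) := by positivity
    have h8 : (0 : ℚ) ≤ (m₂ : ℚ) := by positivity
    simp only [Finset.mem_filter, Finset.mem_range, Finset.mem_singleton,
      show a + b - e = 0 by linarith, Nat.floor_zero]
    constructor
    · rintro ⟨h9, _⟩
      omega
    · rintro rfl
      push_cast
      exact ⟨by norm_num, by linarith, by linarith⟩
  rw [hset, Finset.sum_singleton, Nat.cast_zero, qSign_eq (n := σ) (by linarith),
    qFact_eq (n := n₁) (by linarith), qFact_eq (n := n₂) (by linarith),
    qFact_eq (n := n₃) (by linarith), qFact_eq (n := 0) (by simp),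
    qFact_eq (n := 0) (by push_cast; linarith), qFact_eq (n := m₁) (by linarith),
    qFact_eq (n := m₂) (by linarith), qFact_eq (n := m₃) (by linarith), qfac_zero, one_mul, one_mul]

/-- The smallest admissible `z` is `r = k + f - c - b`, so `z = r + y`; the result has the shape of
the inner sum of `sum_racah_sum`. -/
theorem q6j_eq_shifted_sum (η : ℂ) (s : ℕ → ℂ) {k j c f d b : ℚ}
    (t₁ : IsTriad k j c) (t₂ : IsTriad k d b) (t₃ : IsTriad f j b) (t₄ : IsTriad f d c)
    {r B D L t E C σ : ℕ} (hr : k + f - c - b = r) (hB : c + d - f = B) (hD : d + b - k = D)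
    (hL : 2 * c = L) (ht : c + k - j = t) (hE : j + b - f + t = E) (hC : 2 * b + r + 1 = C)
    (htL : t ≤ L) (htE : t ≤ E) (hσ : k + j + d + f + r = σ) :
    q6j η s k j c f d b = nabla s k d b * nabla s f j b / (nabla s k j c * nabla s f d c) *
      ((-1) ^ σ * ∑ y ∈ (Finset.range (B + 1)).filter (fun y => t + y ≤ L),
      (-1) ^ y * (qfac η (D + r + y) * qfac η (E - t + (r + y)) * qfac η (L - y)) /
        (qfac η (r + y) * qfac η (B - y) * qfac η (L - t - y) * qfac η y *
          qfac η (C + y))) := by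
  rw [q6j, if_pos ⟨t₁, t₂, t₃, t₄⟩]
  congr 1
  rw [Finset.mul_sum]
  have hfl : ⌊k + d - b⌋₊ = B + r := by
    rw [show k + d - b = ((B + r : ℕ) : ℚ) by push_cast; linarith, Nat.floor_natCast]
  refine Finset.sum_nbij' (fun z => z - r) (fun y => r + y) ?_ ?_ ?_ ?_ ?_
  · intro z hz
    simp only [Finset.mem_filter, Finset.mem_range, hfl] at hz ⊢
    obtain ⟨h1, h2, h3⟩ := hz
    have h4 : ((t + z : ℕ) : ℚ) ≤ ((L + r : ℕ) : ℚ) := by push_cast; linarith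
    have h4 : t + z ≤ L + r := by exact_mod_cast h4
    omega
  · intro y hy
    simp only [Finset.mem_filter, Finset.mem_range, hfl] at hy ⊢
    obtain ⟨h1, h2⟩ := hy
    have h4 : ((t + y : ℕ) : ℚ) ≤ (L : ℚ) := by exact_mod_cast h2
    have h5 : (0 : ℚ) ≤ (y : ℚ) := by positivity
    push_cast at h4 ⊢
    exact ⟨by omega, by linarith, by linarith⟩
  · intro z hz
    simp only [Finset.mem_filter] at hz
    obtain ⟨h1, h2, h3⟩ := hz
    have h4 : (r : ℚ) ≤ z := by linarith
    have h4 : r ≤ z := by exact_mod_cast h4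
    omega
  · intro y _
    simp
  · intro z hz
    simp only [Finset.mem_filter, Finset.mem_range, hfl] at hz
    obtain ⟨h1, h2, h3⟩ := hz
    have h4 : (r : ℚ) ≤ z := by linarith
    have h4 : r ≤ z := by exact_mod_cast h4
    obtain ⟨y, rfl⟩ := Nat.exists_eq_add_of_le h4
    have h5 : ((t + y : ℕ) : ℚ) ≤ (L : ℚ) := by push_cast at h2 ⊢; linarith
    have h5 : t + y ≤ L := by exact_mod_cast h5
    rw [Nat.add_sub_cancel_left, qSign_eq (n := σ + y) (by push_cast; linarith),
      qFact_eq (n := D + r + y) (by push_cast; linarith),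
      qFact_eq (n := E - t + (r + y)) (by push_cast [Nat.cast_sub htE]; linarith),
      qFact_eq (n := L - y) (by push_cast [Nat.cast_sub (show y ≤ L by omega)]; linarith),
      qFact_eq (n := r + y) rfl,
      qFact_eq (n := B - y) (by push_cast [Nat.cast_sub (show y ≤ B by omega)]; linarith),
      qFact_eq (n := L - t - y) (by
        rw [Nat.cast_sub (show y ≤ L - t by omega), Nat.cast_sub htL]; push_cast; linarith),
      qFact_eq (n := y) (by push_cast; linarith),
      qFact_eq (n := C + y) (by push_cast; linarith), pow_add]
    ring

/-! ### The doubly stretched `q`-`9j` coefficient -/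

/-- The terms of the doubly stretched `q`-`9j` coefficient, in terms of `t = c + k - j`. -/
theorem stretched_q9j_term {η : ℂ} {s : ℕ → ℂ}
    (hη : ∀ n : ℕ, 1 ≤ n → qNum η n ≠ 0) (hs : ∀ n : ℕ, s n ^ 2 = qNum η n)
    {a b c d e f g h k : ℚ} (ha : a = c + h) (he : e = a + b)
    {B P D G E₃ H₁ H₂ t : ℕ} (hB : c + d - f = B) (hP : c - d + f = P) (hD : b + d - k = D)
    (hG : b - d + k = G) (hE₃ : f + g - e = E₃) (hH₁ : h + k - g = H₁) (hH₂ : h - k + g = H₂)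
    (hhkg : IsTriad h k g) (hcdf : IsTriad c d f) (hbdk : IsTriad b d k) (hefg : IsTriad e f g)
    {i : ℕ} (hi : i + 2 * t = B + G + (E₃ + H₁) + (B + P))
    (hag : IsTriad a g ((i : ℚ) / 2)) (hfb : IsTriad f b ((i : ℚ) / 2))
    (hkc : IsTriad k c ((i : ℚ) / 2)) (htE : t ≤ B + G) (htP : t ≤ B + P) :
    (-1 : ℂ) ^ i *
      qPow η (-(d * (d + 1)) - e * (e + 1) - h * (h + 1) - (i : ℚ) / 2 * ((i : ℚ) / 2 + 1)) *
      qNum η (i + 1) *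
      q6j η s a c h k g ((i : ℚ) / 2) * q6j η s k ((i : ℚ) / 2) c f d b *
      q6j η s a g ((i : ℚ) / 2) f b e =
    (-1) ^ B * qPow η (-(d * (d + 1)) - e * (e + 1) - h * (h + 1) - (c + k) * (c + k + 1)) *
      (nabla s a b e * nabla s k d b * nabla s f g e /
        (nabla s a c h * nabla s k g h * nabla s f d c)) *
      (qFact η (g + k - h) * qFact η (2 * c) * qFact η (2 * h) * qFact η (2 * b) *
        qFact η (e - f + g) / (qFact η (h - k + g) * qFact η (f + g - e) * qFact η (2 * e + 1))) *
      (qPow η (t * (((B + G + (E₃ + H₁) + (B + P) : ℕ) : ℚ) + 1 - t)) *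
        qNum η (B + G + (E₃ + H₁) + (B + P) + 1 - 2 * t) * qfac η (E₃ + H₁ + (B + P) - t) /
        (qfac η (B + G - t) * qfac η t * qfac η (B + G + (E₃ + H₁) + (B + P) + 1 - t)) *
      ∑ y ∈ (Finset.range (B + 1)).filter (fun y => t + y ≤ B + P),
      (-1) ^ y * (qfac η (D + (E₃ + H₁) + y) * qfac η (B + G - t + (E₃ + H₁ + y)) *
        qfac η (B + P - y)) /
        (qfac η (E₃ + H₁ + y) * qfac η (B - y) * qfac η (B + P - t - y) * qfac η y *
          qfac η (D + (E₃ + H₁) + G + 1 + y))) := by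
  have hiQ : (i : ℚ) + 2 * t = B + G + (E₃ + H₁) + (B + P) := by exact_mod_cast hi
  set r := E₃ + H₁ with hr
  have hrQ : (r : ℚ) = E₃ + H₁ := by rw [hr]; push_cast; ring
  have htEQ : ((B + G - t : ℕ) : ℚ) = B + G - t := by push_cast [Nat.cast_sub htE]; ring
  have htPQ : ((B + P - t : ℕ) : ℚ) = B + P - t := by push_cast [Nat.cast_sub htP]; ring
  have htrQ : ((r + (B + P) - t : ℕ) : ℚ) = r + (B + P) - t := by
    push_cast [Nat.cast_sub (show t ≤ r + (B + P) by omega)]; ring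
  have htMQ : ((B + G + r + (B + P) + 1 - t : ℕ) : ℚ) = B + G + r + (B + P) + 1 - t := by
    push_cast [Nat.cast_sub (show t ≤ B + G + r + (B + P) + 1 by omega)]; ring
  rw [q6j_of_left_eq_add η s ha ⟨⟨B + P, by push_cast; linarith⟩, ⟨H₁ + H₂, by push_cast; linarith⟩,
      ⟨0, by push_cast; linarith⟩⟩ hag hkc hhkg.swap_right.reverse
      (t := t) (n₁ := G + B + E₃) (n₂ := B + P) (n₃ := H₁ + H₂) (m₁ := H₂)
      (m₂ := B + G + r + (B + P) + 1 - t) (σ := H₂ + t + (B + P) + G + B + r)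
      (by linarith) (by push_cast; linarith) (by push_cast; linarith) (by push_cast; linarith)
      (by linarith) (by linarith) (by push_cast; linarith),
    q6j_eq_shifted_sum η s hkc.swap_right hbdk.reverse hfb.swap_right hcdf.reverse
      (r := r) (B := B) (D := D) (L := B + P) (t := t) (E := B + G) (C := D + r + G + 1)
      (σ := G + B + 3 * r + D + (B + P - t))
      (by linarith) (by linarith) (by linarith) (by push_cast; linarith) (by linarith)
      (by push_cast; linarith) (by push_cast; linarith) htP htE (by push_cast; linarith),
    q6j_of_right_eq_add η s he hag ⟨⟨0, by push_cast; linarith⟩,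
      ⟨B + P + (H₁ + H₂), by push_cast; linarith⟩, ⟨D + G, by push_cast; linarith⟩⟩
      hefg.swap_right.reverse hfb
      (n₁ := D + G) (n₂ := H₂ + G + B) (n₃ := r + (B + P) - t) (m₁ := E₃)
      (m₂ := B + G - t) (m₃ := B + P + (H₁ + H₂) + (D + G) + 1)
      (σ := B + P + r + H₂ + G + D)
      (by push_cast; linarith) (by push_cast; linarith) (by linarith) (by linarith)
      (by linarith) (by push_cast; linarith) (by push_cast; linarith),
    nabla_swap_right s k c ((i : ℚ) / 2), nabla_swap_right s f b ((i : ℚ) / 2),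
    qFact_eq (x := g + k - h) (n := G + B + E₃) (by push_cast; linarith),
    qFact_eq (x := 2 * c) (n := B + P) (by push_cast; linarith),
    qFact_eq (x := 2 * h) (n := H₁ + H₂) (by push_cast; linarith),
    qFact_eq (x := 2 * b) (n := D + G) (by push_cast; linarith),
    qFact_eq (x := e - f + g) (n := H₂ + G + B) (by push_cast; linarith),
    qFact_eq (x := h - k + g) (n := H₂) (by linarith),
    qFact_eq (x := f + g - e) (n := E₃) (by linarith),
    qFact_eq (x := 2 * e + 1) (n := B + P + (H₁ + H₂) + (D + G) + 1) (by push_cast; linarith),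
    show B + G + r + (B + P) + 1 - 2 * t = i + 1 by omega]
  -- Put `j = c + k - t` in `-j (j + 1)` and use `2 (c + k) = B + G + r + (B + P)`.
  have e1 : qPow η (-(d * (d + 1)) - e * (e + 1) - h * (h + 1) -
        (i : ℚ) / 2 * ((i : ℚ) / 2 + 1)) =
      qPow η (-(d * (d + 1)) - e * (e + 1) - h * (h + 1) - (c + k) * (c + k + 1)) *
        qPow η (t * (((B + G + r + (B + P) : ℕ) : ℚ) + 1 - t)) := by
    rw [← qPow_add]
    congr 1
    push_cast
    rw [hrQ, ← hiQ, show (i : ℚ) / 2 = c + k - t by linarith]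
    have : (i : ℚ) = 2 * (c + k) - 2 * t := by linarith
    rw [this]
    ring
  have e2 : (-1 : ℂ) ^ i * (-1) ^ (H₂ + t + (B + P) + G + B + r) *
      (-1) ^ (G + B + 3 * r + D + (B + P - t)) * (-1) ^ (B + P + r + H₂ + G + D) = (-1) ^ B := by
    simp only [← pow_add]
    rw [neg_one_pow_eq_pow_mod_two, neg_one_pow_eq_pow_mod_two (n := B)]
    congr 1
    omega
  have n1 := nabla_ne_zero hη hs a g ((i : ℚ) / 2)
  have n2 := nabla_ne_zero hη hs k c ((i : ℚ) / 2)
  have n3 := nabla_ne_zero hη hs f b ((i : ℚ) / 2)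
  have e3 : ∀ N₁ N₂ N₃ u v w x y z : ℂ, N₁ ≠ 0 → N₂ ≠ 0 → N₃ ≠ 0 → N₁ * N₂ / (u * v) *
      (w * N₃ / (N₂ * x)) * (y * z / (N₁ * N₃)) = y * w * z / (u * v * x) := by
    intro N₁ N₂ N₃ u v w x y z h₁ h₂ h₃
    field_simp
  rw [e1, ← e2, ← e3 _ _ _ (nabla s a c h) (nabla s k g h) (nabla s k d b) (nabla s f d c)
    (nabla s a b e) (nabla s f g e) n1 n2 n3]
  ring

/-- The doubly stretched `q`-`9j` coefficient, up to reordering the arguments of `∇`. -/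
theorem stretched_q9j_eq_mul {η : ℂ} {s : ℕ → ℂ}
    (hη : ∀ n : ℕ, 1 ≤ n → qNum η n ≠ 0) (hs : ∀ n : ℕ, s n ^ 2 = qNum η n)
    {a b c d e f g h k : ℚ} (ha : a = c + h) (he : e = a + b)
    {B P D G E₃ H₁ H₂ : ℕ} (hB : c + d - f = B) (hP : c - d + f = P) (hD : b + d - k = D)
    (hG : b - d + k = G) (hE₃ : f + g - e = E₃) (hH₁ : h + k - g = H₁) (hH₂ : h - k + g = H₂)
    (hhkg : IsTriad h k g) (hcdf : IsTriad c d f) (hbdk : IsTriad b d k) (hefg : IsTriad e f g) :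
    q9j η s a b e c d f h k g =
    (-1) ^ B * qPow η (-(d * (d + 1)) - e * (e + 1) - h * (h + 1) - (c + k) * (c + k + 1)) *
      (nabla s a b e * nabla s k d b * nabla s f g e /
        (nabla s a c h * nabla s k g h * nabla s f d c)) *
      (qFact η (g + k - h) * qFact η (2 * c) * qFact η (2 * h) * qFact η (2 * b) *
        qFact η (e - f + g) / (qFact η (h - k + g) * qFact η (f + g - e) * qFact η (2 * e + 1))) *
      (qPow η ((B + G : ℕ) * (B + P : ℕ) + B * ((D + (E₃ + H₁) : ℕ) + 1)) *
        qfac η (D + (E₃ + H₁)) /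
        (qfac η B * qfac η G * qfac η (D + (E₃ + H₁) + B + G + 1))) := by
  have hdk : d + k - b = B + E₃ + H₁ := by linarith
  rw [← sum_racah_sum hη B P D G (E₃ + H₁), Finset.mul_sum, q9j]
  symm
  -- The bounds on `t` amount to the triads `(f, b, j)` and `(k, c, j)`; they imply `(a, g, j)`.
  have htri : ∀ t ≤ min (B + G) (B + P), B ≤ D + t → ∀ i : ℕ,
      i + 2 * t = B + G + (E₃ + H₁) + (B + P) → IsTriad a g ((i : ℚ) / 2) ∧
      IsTriad f b ((i : ℚ) / 2) ∧ IsTriad k c ((i : ℚ) / 2) := by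
    intro t ht hBt i hi
    obtain ⟨u, hu⟩ := Nat.exists_eq_add_of_le (ht.trans (min_le_left _ _))
    obtain ⟨v, hv⟩ := Nat.exists_eq_add_of_le (ht.trans (min_le_right _ _))
    obtain ⟨w, hw⟩ := Nat.exists_eq_add_of_le hBt
    have hiQ : (i : ℚ) + 2 * t = B + G + (E₃ + H₁) + (B + P) := by exact_mod_cast hi
    have hu : (B : ℚ) + G = t + u := by exact_mod_cast hu
    have hv : (B : ℚ) + P = t + v := by exact_mod_cast hv
    have hw : (D : ℚ) + t = B + w := by exact_mod_cast hw
    exact ⟨⟨⟨H₂ + t, by push_cast; linarith⟩, ⟨H₁ + v, by push_cast; linarith⟩,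
        ⟨E₃ + u, by push_cast; linarith⟩⟩,
      ⟨⟨w, by linarith⟩, ⟨E₃ + H₁ + v, by push_cast; linarith⟩, ⟨u, by linarith⟩⟩,
      ⟨⟨t, by linarith⟩, ⟨E₃ + H₁ + u, by push_cast; linarith⟩, ⟨v, by linarith⟩⟩⟩
  refine Finset.sum_bij (fun t _ => B + G + (E₃ + H₁) + (B + P) - 2 * t) ?_ ?_ ?_ ?_
  · intro t ht
    simp only [Finset.mem_filter, Finset.mem_range] at ht ⊢
    have hi : B + G + (E₃ + H₁) + (B + P) - 2 * t + 2 * t = B + G + (E₃ + H₁) + (B + P) := by omega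
    generalize B + G + (E₃ + H₁) + (B + P) - 2 * t = i at hi
    obtain ⟨h1, h2, h3⟩ := htri t (by omega) ht.2 i hi
    refine ⟨Nat.lt_succ_of_le (Nat.le_floor ?_), h1, h2, h3⟩
    obtain ⟨⟨n, hn⟩, _⟩ := h1
    have : (0 : ℚ) ≤ n := by positivity
    linarith
  · intro t ht t' ht' h
    simp only [Finset.mem_filter, Finset.mem_range] at ht ht'
    omega
  · intro i hi
    simp only [Finset.mem_filter, Finset.mem_range] at hi
    obtain ⟨_, _, ⟨⟨n, hn⟩, _, ⟨m, hm⟩⟩, ⟨⟨t, ht⟩, _, ⟨l, hl⟩⟩⟩ := hi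
    have h1 : ((i + 2 * t : ℕ) : ℚ) = (B + G + (E₃ + H₁) + (B + P) : ℕ) := by
      push_cast; linarith
    have h2 : ((B + G : ℕ) : ℚ) = (t + m : ℕ) := by push_cast; linarith
    have h3 : ((B + P : ℕ) : ℚ) = (t + l : ℕ) := by push_cast; linarith
    have h4 : ((D + t : ℕ) : ℚ) = (B + n : ℕ) := by push_cast; linarith
    have h1 : i + 2 * t = B + G + (E₃ + H₁) + (B + P) := by exact_mod_cast h1
    have h2 : B + G = t + m := by exact_mod_cast h2
    have h3 : B + P = t + l := by exact_mod_cast h3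
    have h4 : D + t = B + n := by exact_mod_cast h4
    refine ⟨t, ?_, by omega⟩
    simp only [Finset.mem_filter, Finset.mem_range]
    omega
  · intro t ht
    simp only [Finset.mem_filter, Finset.mem_range] at ht
    have hi : B + G + (E₃ + H₁) + (B + P) - 2 * t + 2 * t = B + G + (E₃ + H₁) + (B + P) := by omega
    obtain ⟨h1, h2, h3⟩ := htri t (by omega) ht.2 _ hi
    exact (stretched_q9j_term hη hs ha he hB hP hD hG hE₃ hH₁ hH₂ hhkg hcdf hbdk hefg hi h1 h2 h3
      (by omega) (by omega)).symm

theorem mainTheorem5 (η : ℂ) (s : ℕ → ℂ)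
    (hη : ∀ n : ℕ, 1 ≤ n → qNum η n ≠ 0)
    (hs : ∀ n : ℕ, s n ^ 2 = qNum η n)
    (a b c d e f g h k : ℚ)
    (ha : a = c + h) (he : e = a + b)
    (hcdf : IsTriad c d f) (hhkg : IsTriad h k g)
    (hbdk : IsTriad b d k) (hefg : IsTriad e f g) :
    q9j η s a b e c d f h k g =
      qSign (c + d - f) *
        qPow η (2 * b * c - e * (e + 1) - f * (f + 1) - h * (h + 1) - k * (k + 1)) *
        nabla s e f g / (nabla s h g k * nabla s c d f * nabla s b d k) *
        (sqrtQFact s (2 * b) * sqrtQFact s (2 * c) * sqrtQFact s (2 * h) /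
          (s ⌊2 * a + 1⌋₊ * sqrtQFact s (2 * e + 1))) := by
  obtain ⟨B, hB⟩ := hcdf.1
  obtain ⟨P, hP⟩ := hcdf.2.1
  obtain ⟨D, hD⟩ := hbdk.1
  obtain ⟨G, hG⟩ := hbdk.2.1
  obtain ⟨E₃, hE₃⟩ := hefg.2.2
  obtain ⟨H₁, hH₁⟩ := hhkg.1
  obtain ⟨H₂, hH₂⟩ := hhkg.2.1
  have n := sqrtQFact_ne_zero hη hs
  have m := nabla_ne_zero hη hs
  have hsq := sqrtQFact_sq hs
  have hq : ∀ x, qFact η x ≠ 0 := fun x => hsq x ▸ pow_ne_zero 2 (n x)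
  have r1 := nabla_mul_nabla hη hs b d k
  have r2 := nabla_mul_qFact hη hs c d f
  have r3 := nabla_mul_qFact hη hs h g k
  have r4 := nabla_mul_qFact hη hs e g f
  rw [nabla_swap_right s e f g, show g + f - e = f + g - e by ring,
    show e + g - f = e - f + g by ring] at r4
  rw [show h + g - k = h - k + g by ring] at r3
  -- In `∇[abe]` and `∇[ach]` stretching turns one factorial into `[0]!`; in their quotient `[2a]!`
  -- cancels, leaving the square root of `[2a + 1]`.
  have r5 : nabla s a b e =
      sqrtQFact s (2 * a) * sqrtQFact s (2 * e + 1) / sqrtQFact s (2 * b) := by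
    rw [nabla, show a + b - e = 0 by linarith, show a - b + e = 2 * a by linarith,
      show a + b + e + 1 = 2 * e + 1 by linarith, show b + e - a = 2 * b by linarith]
    simp [sqrtQFact]
  have h1 : 2 * a = (B + P + (H₁ + H₂) : ℕ) := by push_cast; linarith
  have h2 : 2 * a + 1 = (B + P + (H₁ + H₂) + 1 : ℕ) := by rw [h1]; push_cast; ring
  have r6 : nabla s a c h =
      sqrtQFact s (2 * c) * sqrtQFact s (2 * h) * (sqrtQFact s (2 * a) * s ⌊2 * a + 1⌋₊) := by
    rw [nabla, show a + c - h = 2 * c by linarith, show a - c + h = 2 * h by linarith,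
      show a + c + h + 1 = 2 * a + 1 by linarith, show c + h - a = 0 by linarith,
      sqrtQFact_eq h1, sqrtQFact_eq h2, h2, Nat.floor_natCast]
    simp [sqrtQFact, sqrtQfac, Finset.prod_range_succ]
  have n1 : s ⌊2 * a + 1⌋₊ ≠ 0 := by
    rw [h2, Nat.floor_natCast]
    exact fun h => hη (B + P + (H₁ + H₂) + 1) (by omega) (by rw [← hs, h]; ring)
  have e1 : qPow η (2 * b * c - e * (e + 1) - f * (f + 1) - h * (h + 1) - k * (k + 1)) =
      qPow η (-(d * (d + 1)) - e * (e + 1) - h * (h + 1) - (c + k) * (c + k + 1)) *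
      qPow η ((B + G : ℕ) * (B + P : ℕ) + B * ((D + (E₃ + H₁) : ℕ) + 1)) := by
    rw [← qPow_add]
    congr 1
    push_cast
    rw [← hB, ← hP, ← hG, ← hD, ← hE₃, ← hH₁, he, ha]
    ring
  rw [stretched_q9j_eq_mul hη hs ha he hB hP hD hG hE₃ hH₁ hH₂ hhkg hcdf hbdk hefg, r5, r6, e1,
    qSign_eq hB, ← qFact_eq (x := d + f - c) (n := D + (E₃ + H₁)) (by push_cast; linarith),
    ← qFact_eq (x := c + d - f) (n := B) hB, ← qFact_eq (x := b - d + k) (n := G) hG,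
    ← qFact_eq (x := b + d + k + 1) (n := D + (E₃ + H₁) + B + G + 1) (by push_cast; linarith),
    eq_div_of_mul_eq (hq _) r4, eq_div_of_mul_eq (m h g k) ((mul_comm _ _).trans r3),
    eq_div_of_mul_eq (m c d f) ((mul_comm _ _).trans r2),
    eq_div_of_mul_eq (m b d k) ((mul_comm _ _).trans r1),
    ← hsq (2 * c), ← hsq (2 * h), ← hsq (2 * b), ← hsq (2 * e + 1)]
  have m1 := m k g h
  have m2 := m f d c
  have m3 := m h g k
  have m4 := m c d f
  have m5 := m b d k
  have m6 := m f g e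
  have n2 := n (2 * a)
  have n3 := n (2 * b)
  have n4 := n (2 * c)
  have n5 := n (2 * h)
  have n6 := n (2 * e + 1)
  have q1 := hq (h - k + g)
  have q2 := hq (f + g - e)
  have q3 := hq (e - f + g)
  have q4 := hq (c + d - f)
  have q5 := hq (b - d + k)
  have q6 := hq (b + d + k + 1)
  field_simp
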